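/- For $n\in\mathbb Z$ put $\{n\}=\frac{q^{2n}-1}{q^2-1}\in\mathbb Q(q)$ and, for $x\in\mathbb Q$ with continued fraction $x=a_1+\cfrac{1}{a_2+\cfrac{1}{\ddots+\cfrac1{a_{2m}}}}$ of even length ($a_i\in\mathbb Z$, $a_i\ge 1$ for $i\ge2$), let $$\{x\}=\{a_1\}+\cfrac{q^{2a_1}}{\{a_2\}_{q^{-1}}+\cfrac{q^{-2a_2}}{\{a_3\}+\cfrac{q^{2a_3}}{\ddots+\cfrac{q^{2a_{2m-1}}}{\{a_{2m}\}_{q^{-1}}}}}}$$ be its $q$-deformation, where $\{a\}_{q^{-1}}$ is $\{a\}$ with $q$ replaced by $q^{-1}$. Put $\delta_x=\{x\}-\{x-1\}$ and $\binom{x}{k}_q=\frac{\{x\}\{x-1\}\cdots\{x-k+1\}}{\{k\}\{k-1\}\cdots\{1\}}$. Let $R$ be a nonzero commutative $\mathbb Q(q)$-algebra with an element $\nu$ such that $\nu^2=\delta_x^{-1}$ (for instance $R=\mathbb Q(q)[\nu]/(\nu^2-\delta_x^{-1})$). Let $x\mathbf{Web}$ be the $R$-linear category obtained from the universal (HOMFLY-PT)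 category $\infty\mathbf{Web}$ of oriented $\mathfrak{gl}$-webs with edges labelled by positive integers by setting $a=q\nu\delta_x$, so that a $1$-labelled circle has value $\frac{a-a^{-1}}{q-q^{-1}}$. Then: 1. For every $k\ge 1$, both orientations of the $k$-labelled circle equal $q^{k(k-1)}\nu^k\binom{x}{k}_q\cdot \mathrm{id}_\emptyset$ in $\mathrm{End}_{x\mathbf{Web}}(\emptyset)$. 2. For every $k\ge 0$, $\binom{x}{k}_q\ne0$ unless $x\in\mathbb N$ and $x<k$. 3. Let $n\in\mathbb N$, and let $M$ be the $R$-module of endomorphisms of $\emptyset$ in the quotient of $x\mathbf{Web}$ by the two-sided tensor ideal generated by the identities of the $k$-labelled edges with $k>n$. Unless $x\in\mathbb N$ and $x\le n$, the class of $\mathrm{id}_\emptyset$ in $M$ is a torsion element: some non-zero-divisor $r\in R$ satisfies $r\cdot[\mathrm{id}_\emptyset]=0$ in $M$. -/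

import Mathlib

open CategoryTheory MonoidalCategory

universe u

namespace QWeb

noncomputable section

/-! ### Quantum integers and `q`-rationals -/

/-- The field `ℚ(q)`. -/
abbrev Qq : Type := RatFunc ℚ

/-- The variable `q`. -/
def q : Qq := RatFunc.X

/-- The quantum integer `{n} = (q^{2n} - 1) / (q^2 - 1)`. -/
def qInt (n : ℤ) : Qq := (q ^ (2 * n) - 1) / (q ^ 2 - 1)

/-- The quantum integer `{n}` with `q` replaced by `q⁻¹`. -/
def qIntInv (n : ℤ) : Qq := (q ^ (-(2 * n)) - 1) / (q ^ (-2 : ℤ) - 1)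

/-- The quantum factorial `{k}! = {k}{k-1}⋯{1}`. -/
def qFactorial (k : ℕ) : Qq := ∏ i ∈ Finset.range k, qInt (i + 1)

/-- The quantum binomial coefficient `{n}{n-1}⋯{n-k+1} / {k}!` for an integer `n`. -/
def qBinomInt (n : ℤ) (k : ℕ) : Qq := (∏ i ∈ Finset.range k, qInt (n - i)) / qFactorial k

/-- The entries of the even continued fraction
`x = a₁ + 1/(b₁ + 1/(a₂ + 1/(b₂ + ⋯)))`, grouped in pairs: the first pair `(a₁, b₁)` and the list
`[(a₂, b₂), …]` of the others. All entries except possibly `a₁` are positive. An integer `x` is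
written `(x - 1) + 1/1`, which makes the number of entries even. -/
def evenCF (x : ℚ) : (ℤ × ℤ) × List (ℤ × ℤ) :=
  if Int.fract x = 0 then ((⌊x⌋ - 1, 1), [])
  else if _hy : Int.fract (Int.fract x)⁻¹ = 0 then ((⌊x⌋, ⌊(Int.fract x)⁻¹⌋), [])
  else
    let r := evenCF (Int.fract (Int.fract x)⁻¹)⁻¹
    ((⌊x⌋, ⌊(Int.fract x)⁻¹⌋), r.1 :: r.2)
termination_by x.den
decreasing_by
  have key : ∀ z : ℚ, Int.fract z ≠ 0 → ((Int.fract z)⁻¹).den < z.den := by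
    intro z hz
    have h0 : 0 < Int.fract z := lt_of_le_of_ne (Int.fract_nonneg z) (Ne.symm hz)
    have h1 : Int.fract z < 1 := Int.fract_lt_one z
    have hden : (Int.fract z).den = z.den := by
      have : Int.fract z = z - (⌊z⌋ : ℚ) := rfl
      rw [this, Rat.sub_intCast_den]
    have hnum : 0 < (Int.fract z).num := Rat.num_pos.mpr h0
    have hlt : (Int.fract z).num < (Int.fract z).den := Rat.num_lt_denom_iff.mpr h1
    have hinv : ((Int.fract z)⁻¹).den = (Int.fract z).num.natAbs := by
      rw [Rat.den_inv_of_ne_zero h0.ne']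
    omega
  exact lt_trans (key _ _hy) (key _ ‹_›)

/-- The deformation
`{a₁} + q^{2a₁} / ({b₁}_{q⁻¹} + q^{-2b₁} / ({a₂} + q^{2a₂} / ({b₂}_{q⁻¹} + ⋯)))`
of the continued fraction with entries `a₁, b₁, a₂, b₂, …`. -/
def qCF : ℤ × ℤ → List (ℤ × ℤ) → Qq
  | (a, b), [] => qInt a + q ^ (2 * a) / qIntInv b
  | (a, b), p :: l => qInt a + q ^ (2 * a) / (qIntInv b + q ^ (-(2 * b)) / qCF p l)

/-- The `q`-rational `{x}`. -/
def qRat (x : ℚ) : Qq := qCF (evenCF x).1 (evenCF x).2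

/-- `{x choose k} = {x}{x-1}⋯{x-k+1} / {k}!`. -/
def qBinom (x : ℚ) (k : ℕ) : Qq := (∏ i ∈ Finset.range k, qRat (x - i)) / qFactorial k

/-- `δ_x = {x} - {x-1}`. -/
def qDelta (x : ℚ) : Qq := qRat x - qRat (x - 1)

/-! ### Objects and generating morphisms of the web category -/

/-- Words in upward and downward arrows labelled by positive integers (parenthesized tensor
products of them; the empty word is `unit`). -/
inductive WebObj : Type
  | unit : WebObj
  | up : ℕ+ → WebObj
  | down : ℕ+ → WebObj
  | tensor : WebObj → WebObj → WebObj

local infixr:70 " ⊙ " => WebObj.tensor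

/-- Formal `R`-linear expressions in the generating webs. A term of `WebTerm R X Y` stands for a
combination of webs with bottom boundary `X` and top boundary `Y`. -/
inductive WebTerm (R : Type u) : WebObj → WebObj → Type u
  | idn (X : WebObj) : WebTerm R X X
  | comp {X Y Z : WebObj} (f : WebTerm R X Y) (g : WebTerm R Y Z) : WebTerm R X Z
  | tens {X Y X' Y' : WebObj} (f : WebTerm R X Y) (g : WebTerm R X' Y') :
      WebTerm R (X ⊙ X') (Y ⊙ Y')
  | assoc (X Y Z : WebObj) : WebTerm R ((X ⊙ Y) ⊙ Z) (X ⊙ (Y ⊙ Z))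
  | assocInv (X Y Z : WebObj) : WebTerm R (X ⊙ (Y ⊙ Z)) ((X ⊙ Y) ⊙ Z)
  | lunit (X : WebObj) : WebTerm R (WebObj.unit ⊙ X) X
  | lunitInv (X : WebObj) : WebTerm R X (WebObj.unit ⊙ X)
  | runit (X : WebObj) : WebTerm R (X ⊙ WebObj.unit) X
  | runitInv (X : WebObj) : WebTerm R X (X ⊙ WebObj.unit)
  | zero (X Y : WebObj) : WebTerm R X Y
  | add {X Y : WebObj} (f g : WebTerm R X Y) : WebTerm R X Y
  | smul {X Y : WebObj} (r : R) (f : WebTerm R X Y) : WebTerm R X Y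
  /-- the trivalent vertex merging `k` and `l` into `m = k + l` -/
  | merge (k l m : ℕ+) (h : k + l = m) : WebTerm R (WebObj.up k ⊙ WebObj.up l) (WebObj.up m)
  /-- the trivalent vertex splitting `m = k + l` into `k` and `l` -/
  | split (k l m : ℕ+) (h : k + l = m) : WebTerm R (WebObj.up m) (WebObj.up k ⊙ WebObj.up l)
  | cupUD (k : ℕ+) : WebTerm R WebObj.unit (WebObj.up k ⊙ WebObj.down k)
  | cupDU (k : ℕ+) : WebTerm R WebObj.unit (WebObj.down k ⊙ WebObj.up k)
  | capUD (k : ℕ+) : WebTerm R (WebObj.up k ⊙ WebObj.down k) WebObj.unit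
  | capDU (k : ℕ+) : WebTerm R (WebObj.down k ⊙ WebObj.up k) WebObj.unit

/- Composition is read from bottom to top: `f ⋗ g` is `f` with `g` stacked above it. -/
local infixr:60 " ⋗ " => WebTerm.comp
local infixr:70 " ⊠ " => WebTerm.tens
local infixr:75 " ∙ₛ " => WebTerm.smul
local infixl:55 " ∔ " => WebTerm.add

namespace WebTerm

variable {R : Type u}

/-! #### Duality -/

/-- The dual object: reverse the word and the orientations. -/
def dual : WebObj → WebObj
  | .unit => .unit
  | .up k => .down k
  | .down k => .up k
  | .tensor X Y => dual Y ⊙ dual X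

/-- Nested cups with `X` on the left. -/
def coev : (X : WebObj) → WebTerm R .unit (X ⊙ dual X)
  | .unit => lunitInv .unit
  | .up k => cupUD k
  | .down k => cupDU k
  | .tensor X Y => coev X ⋗ (idn X ⊠ (lunitInv (dual X) ⋗ (coev Y ⊠ idn (dual X)) ⋗
      assoc Y (dual Y) (dual X))) ⋗ assocInv X Y (dual Y ⊙ dual X)

/-- Nested caps with `X` on the right. -/
def ev : (X : WebObj) → WebTerm R (dual X ⊙ X) .unit
  | .unit => lunit .unit
  | .up k => capDU k
  | .down k => capUD k
  | .tensor X Y => assoc (dual Y) (dual X) (X ⊙ Y) ⋗ (idn (dual Y) ⊠ (assocInv (dual X) X Y ⋗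
      (ev X ⊠ idn Y) ⋗ lunit Y)) ⋗ ev Y

/-- Nested cups with `X` on the right. -/
def coev' : (X : WebObj) → WebTerm R .unit (dual X ⊙ X)
  | .unit => lunitInv .unit
  | .up k => cupDU k
  | .down k => cupUD k
  | .tensor X Y => coev' Y ⋗ (idn (dual Y) ⊠ (lunitInv Y ⋗ (coev' X ⊠ idn Y) ⋗
      assoc (dual X) X Y)) ⋗ assocInv (dual Y) (dual X) (X ⊙ Y)

/-- Nested caps with `X` on the left. -/
def ev' : (X : WebObj) → WebTerm R (X ⊙ dual X) .unit
  | .unit => lunit .unit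
  | .up k => capUD k
  | .down k => capDU k
  | .tensor X Y => assoc X Y (dual Y ⊙ dual X) ⋗ (idn X ⊠ (assocInv Y (dual Y) (dual X) ⋗
      (ev' Y ⊠ idn (dual X)) ⋗ lunit (dual X))) ⋗ ev' X

/-- The half rotation of `f` in one direction. -/
def rightMate {X Y : WebObj} (f : WebTerm R X Y) : WebTerm R (dual Y) (dual X) :=
  runitInv (dual Y) ⋗ (idn (dual Y) ⊠ coev X) ⋗ (idn (dual Y) ⊠ (f ⊠ idn (dual X))) ⋗
    assocInv (dual Y) Y (dual X) ⋗ (ev Y ⊠ idn (dual X)) ⋗ lunit (dual X)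

/-- The half rotation of `f` in the other direction. -/
def leftMate {X Y : WebObj} (f : WebTerm R X Y) : WebTerm R (dual Y) (dual X) :=
  lunitInv (dual Y) ⋗ (coev' X ⊠ idn (dual Y)) ⋗ ((idn (dual X) ⊠ f) ⊠ idn (dual Y)) ⋗
    assoc (dual X) Y (dual Y) ⋗ (idn (dual X) ⊠ ev' Y) ⋗ runit (dual X)

/-! #### Ladders

In the relations between upward webs, edges labelled `0` are erased, and a web with a negative
label is zero. -/

/-- The upward strand labelled `k`, which is empty for `k = 0`. -/
def strand : ℕ → WebObj
  | 0 => .unit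
  | k + 1 => .up k.succPNat

/-- The identity, between strands with equal labels. -/
def strandCast (k m : ℕ) (h : k = m) : WebTerm R (strand k) (strand m) := h ▸ idn (strand k)

/-- The merge vertex `k + l = m`, where edges labelled `0` are erased. -/
def merge₀ : (k l m : ℕ) → k + l = m → WebTerm R (strand k ⊙ strand l) (strand m)
  | 0, l, m, h => lunit (strand l) ⋗ strandCast l m (by omega)
  | k + 1, 0, m, h => runit (strand (k + 1)) ⋗ strandCast (k + 1) m h
  | _ + 1, _ + 1, 0, h => absurd h (by omega)
  | k + 1, l + 1, m + 1, h => merge k.succPNat l.succPNat m.succPNat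
      (PNat.coe_injective (by simpa [PNat.add_coe, Nat.succPNat_coe] using h))

/-- The split vertex `m = k + l`, where edges labelled `0` are erased. -/
def split₀ : (k l m : ℕ) → k + l = m → WebTerm R (strand m) (strand k ⊙ strand l)
  | 0, l, m, h => strandCast m l (by omega) ⋗ lunitInv (strand l)
  | k + 1, 0, m, h => strandCast m (k + 1) h.symm ⋗ runitInv (strand (k + 1))
  | _ + 1, _ + 1, 0, h => absurd h (by omega)
  | k + 1, l + 1, m + 1, h => split k.succPNat l.succPNat m.succPNat
      (PNat.coe_injective (by simpa [PNat.add_coe, Nat.succPNat_coe] using h))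

/-- Two upward strands with labels `k, l` at the bottom and `k', l'` at the top, joined by a rung
labelled `j` going up from the right strand to the left strand. It is zero unless `k' = k + j` and
`l' = l - j ≥ 0`. -/
def rungL (j k l k' l' : ℕ) : WebTerm R (strand k ⊙ strand l) (strand k' ⊙ strand l') :=
  if h : k + j = k' ∧ j + l' = l then
    (idn (strand k) ⊠ split₀ j l' l h.2) ⋗ assocInv (strand k) (strand j) (strand l') ⋗
      (merge₀ k j k' h.1 ⊠ idn (strand l'))
  else zero _ _

/-- Two upward strands with labels `k, l` at the bottom and `k', l'` at the top, joined by a rung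
labelled `j` going up from the left strand to the right strand. It is zero unless
`k' = k - j ≥ 0` and `l' = l + j`. -/
def rungR (j k l k' l' : ℕ) : WebTerm R (strand k ⊙ strand l) (strand k' ⊙ strand l') :=
  if h : k' + j = k ∧ j + l = l' then
    (split₀ k' j k h.1 ⊠ idn (strand l)) ⋗ assoc (strand k') (strand j) (strand l) ⋗
      (idn (strand k') ⊠ merge₀ j l l' h.2)
  else zero _ _

/-- Three upward strands. -/
abbrev strand₃ (k l r : ℕ) : WebObj := (strand k ⊙ strand l) ⊙ strand r

/-- A rung from the second to the first of three strands; the labels of all three strands are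
given at the bottom and, for the strands that change, at the top. -/
def rung21 (j k l r k' l' : ℕ) : WebTerm R (strand₃ k l r) (strand₃ k' l' r) :=
  rungL j k l k' l' ⊠ idn (strand r)

/-- A rung from the first to the second of three strands. -/
def rung12 (j k l r k' l' : ℕ) : WebTerm R (strand₃ k l r) (strand₃ k' l' r) :=
  rungR j k l k' l' ⊠ idn (strand r)

/-- A rung from the third to the second of three strands. -/
def rung32 (j k l r l' r' : ℕ) : WebTerm R (strand₃ k l r) (strand₃ k l' r') :=
  assoc _ _ _ ⋗ (idn (strand k) ⊠ rungL j l r l' r') ⋗ assocInv _ _ _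

/-- A rung from the second to the third of three strands. -/
def rung23 (j k l r l' r' : ℕ) : WebTerm R (strand₃ k l r) (strand₃ k l' r') :=
  assoc _ _ _ ⋗ (idn (strand k) ⊠ rungR j l r l' r') ⋗ assocInv _ _ _

/-! #### Mixed webs with labels `1` and `2` -/

/-- Two strands labelled `1` merging into an edge labelled `2` and splitting again. -/
def dumbbell : WebTerm R (.up 1 ⊙ .up 1) (.up 1 ⊙ .up 1) :=
  merge 1 1 2 rfl ⋗ split 1 1 2 rfl

/-- The web with vertical edges `1, 2, 1` and a sideway edge labelled `1` closing up on the
right. -/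
def sidewayDigonRight : WebTerm R (.up 1) (.up 1) :=
  runitInv _ ⋗ (idn _ ⊠ cupUD 1) ⋗ assocInv _ _ _ ⋗ (dumbbell ⊠ idn _) ⋗ assoc _ _ _ ⋗
    (idn _ ⊠ capUD 1) ⋗ runit _

/-- The web with vertical edges `1, 2, 1` and a sideway edge labelled `1` closing up on the
left. -/
def sidewayDigonLeft : WebTerm R (.up 1) (.up 1) :=
  lunitInv _ ⋗ (cupDU 1 ⊠ idn _) ⋗ assoc _ _ _ ⋗ (idn _ ⊠ dumbbell) ⋗ assocInv _ _ _ ⋗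
    (capDU 1 ⊠ idn _) ⋗ lunit _

/-- The dumbbell with its edge labelled `2` pointing to the right. -/
def dumbbellToRight : WebTerm R (.up 1 ⊙ .down 1) (.down 1 ⊙ .up 1) :=
  lunitInv _ ⋗ (cupDU 1 ⊠ idn _) ⋗ assoc _ _ _ ⋗
    (idn (.down 1) ⊠ (assocInv _ _ _ ⋗ (dumbbell ⊠ idn (.down 1)) ⋗ assoc _ _ _ ⋗
      (idn (.up 1) ⊠ capUD 1) ⋗ runit _))

/-- The dumbbell with its edge labelled `2` pointing to the left. -/
def dumbbellToLeft : WebTerm R (.down 1 ⊙ .up 1) (.up 1 ⊙ .down 1) :=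
  (idn (.down 1) ⊠ (runitInv _ ⋗ (idn (.up 1) ⊠ cupUD 1) ⋗ assocInv _ _ _ ⋗
      (dumbbell ⊠ idn (.down 1)) ⋗ assoc _ _ _)) ⋗
    assocInv _ _ _ ⋗ (capDU 1 ⊠ idn _) ⋗ lunit _

end WebTerm

/-! ### Coefficients and relations -/

section Relations

variable (R : Type u) [CommRing R] [Algebra Qq R]

/-- An element of `ℚ(q)` seen in `R`. -/
abbrev coef (c : Qq) : R := algebraMap Qq R c

variable {R}

/-- `(a q^{-i} - a⁻¹ q^i) / (q - q⁻¹)`, for an invertible element `a` of `R`. -/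
def bracket (a : R) (i : ℕ) : R :=
  coef R (q - q⁻¹)⁻¹ * (a * coef R (q ^ (-(i : ℤ))) - Ring.inverse a * coef R (q ^ i))

/-- The value `μ_k` of the circle labelled `k`:
`∏_{i < k} (a q^{-i} - a⁻¹ q^i) / (q - q⁻¹)` times `q^{k(k-1)/2} / {k}!`. -/
def circleValue (a : R) (k : ℕ) : R :=
  (∏ i ∈ Finset.range k, bracket a i) * coef R (q ^ (k * (k - 1) / 2) / qFactorial k)

open WebTerm

/-- The congruence on formal webs that defines the pivotal `R`-linear monoidal category of webs. -/
inductive WebRel (a : R) : {X Y : WebObj} → WebTerm R X Y → WebTerm R X Y → Prop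
  -- equivalence relation, compatible with all operations
  | refl {X Y} (f : WebTerm R X Y) : WebRel a f f
  | symm {X Y} {f g : WebTerm R X Y} : WebRel a f g → WebRel a g f
  | trans {X Y} {f g h : WebTerm R X Y} : WebRel a f g → WebRel a g h → WebRel a f h
  | comp_congr {X Y Z} {f f' : WebTerm R X Y} {g g' : WebTerm R Y Z} :
      WebRel a f f' → WebRel a g g' → WebRel a (f ⋗ g) (f' ⋗ g')
  | tens_congr {X Y X' Y'} {f f' : WebTerm R X Y} {g g' : WebTerm R X' Y'} :
      WebRel a f f' → WebRel a g g' → WebRel a (f ⊠ g) (f' ⊠ g')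
  | add_congr {X Y} {f f' g g' : WebTerm R X Y} :
      WebRel a f f' → WebRel a g g' → WebRel a (f ∔ g) (f' ∔ g')
  | smul_congr {X Y} (r : R) {f f' : WebTerm R X Y} :
      WebRel a f f' → WebRel a (r ∙ₛ f) (r ∙ₛ f')
  -- `R`-modules
  | add_assoc {X Y} (f g h : WebTerm R X Y) : WebRel a (f ∔ g ∔ h) (f ∔ (g ∔ h))
  | add_comm {X Y} (f g : WebTerm R X Y) : WebRel a (f ∔ g) (g ∔ f)
  | zero_add {X Y} (f : WebTerm R X Y) : WebRel a (zero X Y ∔ f) f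
  | smul_add {X Y} (r : R) (f g : WebTerm R X Y) : WebRel a (r ∙ₛ (f ∔ g)) (r ∙ₛ f ∔ r ∙ₛ g)
  | add_smul {X Y} (r s : R) (f : WebTerm R X Y) : WebRel a ((r + s) ∙ₛ f) (r ∙ₛ f ∔ s ∙ₛ f)
  | mul_smul {X Y} (r s : R) (f : WebTerm R X Y) : WebRel a ((r * s) ∙ₛ f) (r ∙ₛ s ∙ₛ f)
  | one_smul {X Y} (f : WebTerm R X Y) : WebRel a ((1 : R) ∙ₛ f) f
  | zero_smul {X Y} (f : WebTerm R X Y) : WebRel a ((0 : R) ∙ₛ f) (zero X Y)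
  -- category, bilinearity of the composition
  | id_comp {X Y} (f : WebTerm R X Y) : WebRel a (idn X ⋗ f) f
  | comp_id {X Y} (f : WebTerm R X Y) : WebRel a (f ⋗ idn Y) f
  | comp_assoc {W X Y Z} (f : WebTerm R W X) (g : WebTerm R X Y) (h : WebTerm R Y Z) :
      WebRel a ((f ⋗ g) ⋗ h) (f ⋗ (g ⋗ h))
  | add_comp {X Y Z} (f g : WebTerm R X Y) (h : WebTerm R Y Z) :
      WebRel a ((f ∔ g) ⋗ h) ((f ⋗ h) ∔ (g ⋗ h))
  | comp_add {X Y Z} (f : WebTerm R X Y) (g h : WebTerm R Y Z) :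
      WebRel a (f ⋗ (g ∔ h)) ((f ⋗ g) ∔ (f ⋗ h))
  | smul_comp {X Y Z} (r : R) (f : WebTerm R X Y) (g : WebTerm R Y Z) :
      WebRel a ((r ∙ₛ f) ⋗ g) (r ∙ₛ (f ⋗ g))
  | comp_smul {X Y Z} (r : R) (f : WebTerm R X Y) (g : WebTerm R Y Z) :
      WebRel a (f ⋗ (r ∙ₛ g)) (r ∙ₛ (f ⋗ g))
  -- monoidal category, bilinearity of the tensor product
  | id_tens_id (X Y) : WebRel a (idn X ⊠ idn Y) (idn (X ⊙ Y))
  | tens_comp_tens {X₁ Y₁ Z₁ X₂ Y₂ Z₂} (f₁ : WebTerm R X₁ Y₁) (f₂ : WebTerm R X₂ Y₂)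
      (g₁ : WebTerm R Y₁ Z₁) (g₂ : WebTerm R Y₂ Z₂) :
      WebRel a ((f₁ ⊠ f₂) ⋗ (g₁ ⊠ g₂)) ((f₁ ⋗ g₁) ⊠ (f₂ ⋗ g₂))
  | add_tens {X Y X' Y'} (f g : WebTerm R X Y) (h : WebTerm R X' Y') :
      WebRel a ((f ∔ g) ⊠ h) ((f ⊠ h) ∔ (g ⊠ h))
  | tens_add {X Y X' Y'} (f : WebTerm R X Y) (g h : WebTerm R X' Y') :
      WebRel a (f ⊠ (g ∔ h)) ((f ⊠ g) ∔ (f ⊠ h))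
  | smul_tens {X Y X' Y'} (r : R) (f : WebTerm R X Y) (g : WebTerm R X' Y') :
      WebRel a ((r ∙ₛ f) ⊠ g) (r ∙ₛ (f ⊠ g))
  | tens_smul {X Y X' Y'} (r : R) (f : WebTerm R X Y) (g : WebTerm R X' Y') :
      WebRel a (f ⊠ (r ∙ₛ g)) (r ∙ₛ (f ⊠ g))
  | assoc_naturality {X₁ X₂ X₃ Y₁ Y₂ Y₃} (f₁ : WebTerm R X₁ Y₁) (f₂ : WebTerm R X₂ Y₂)
      (f₃ : WebTerm R X₃ Y₃) :
      WebRel a (((f₁ ⊠ f₂) ⊠ f₃) ⋗ assoc Y₁ Y₂ Y₃) (assoc X₁ X₂ X₃ ⋗ (f₁ ⊠ (f₂ ⊠ f₃)))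
  | lunit_naturality {X Y} (f : WebTerm R X Y) :
      WebRel a ((idn .unit ⊠ f) ⋗ lunit Y) (lunit X ⋗ f)
  | runit_naturality {X Y} (f : WebTerm R X Y) :
      WebRel a ((f ⊠ idn .unit) ⋗ runit Y) (runit X ⋗ f)
  | assoc_assocInv (X Y Z) : WebRel a (assoc X Y Z ⋗ assocInv X Y Z) (idn _)
  | assocInv_assoc (X Y Z) : WebRel a (assocInv X Y Z ⋗ assoc X Y Z) (idn _)
  | lunit_lunitInv (X) : WebRel a (lunit X ⋗ lunitInv X) (idn _)
  | lunitInv_lunit (X) : WebRel a (lunitInv X ⋗ lunit X) (idn _)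
  | runit_runitInv (X) : WebRel a (runit X ⋗ runitInv X) (idn _)
  | runitInv_runit (X) : WebRel a (runitInv X ⋗ runit X) (idn _)
  | pentagon (W X Y Z) :
      WebRel a ((assoc W X Y ⊠ idn Z) ⋗ (assoc W (X ⊙ Y) Z ⋗ (idn W ⊠ assoc X Y Z)))
        (assoc (W ⊙ X) Y Z ⋗ assoc W X (Y ⊙ Z))
  | triangle (X Y) : WebRel a (assoc X .unit Y ⋗ (idn X ⊠ lunit Y)) (runit X ⊠ idn Y)
  -- pivotal structure (isotopy): cups and caps straighten, full rotations are trivial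
  | zigzag_up (k : ℕ+) :
      WebRel a (lunitInv (.up k) ⋗ (cupUD k ⊠ idn (.up k)) ⋗ assoc _ _ _ ⋗
        (idn (.up k) ⊠ capDU k) ⋗ runit (.up k)) (idn (.up k))
  | zigzag_down (k : ℕ+) :
      WebRel a (runitInv (.down k) ⋗ (idn (.down k) ⊠ cupUD k) ⋗ assocInv _ _ _ ⋗
        (capDU k ⊠ idn (.down k)) ⋗ lunit (.down k)) (idn (.down k))
  | zigzag_up' (k : ℕ+) :
      WebRel a (runitInv (.up k) ⋗ (idn (.up k) ⊠ cupDU k) ⋗ assocInv _ _ _ ⋗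
        (capUD k ⊠ idn (.up k)) ⋗ lunit (.up k)) (idn (.up k))
  | zigzag_down' (k : ℕ+) :
      WebRel a (lunitInv (.down k) ⋗ (cupDU k ⊠ idn (.down k)) ⋗ assoc _ _ _ ⋗
        (idn (.down k) ⊠ capUD k) ⋗ runit (.down k)) (idn (.down k))
  | pivotal {X Y} (f : WebTerm R X Y) : WebRel a (leftMate f) (rightMate f)
  -- upward webs
  | merge_assoc (k l r kl lr s : ℕ+) (h₁ : k + l = kl) (h₂ : kl + r = s) (h₃ : l + r = lr)
      (h₄ : k + lr = s) :
      WebRel a ((merge k l kl h₁ ⊠ idn (.up r)) ⋗ merge kl r s h₂)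
        (assoc _ _ _ ⋗ (idn (.up k) ⊠ merge l r lr h₃) ⋗ merge k lr s h₄)
  | split_assoc (k l r kl lr s : ℕ+) (h₁ : k + l = kl) (h₂ : kl + r = s) (h₃ : l + r = lr)
      (h₄ : k + lr = s) :
      WebRel a (split kl r s h₂ ⋗ (split k l kl h₁ ⊠ idn (.up r)))
        (split k lr s h₄ ⋗ (idn (.up k) ⊠ split l r lr h₃) ⋗ assocInv _ _ _)
  | digon (k l m : ℕ+) (h : k + l = m) :
      WebRel a (split k l m h ⋗ merge k l m h)
        (coef R (q ^ (-((k : ℤ) * l)) * qBinomInt m k) ∙ₛ idn (.up m))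
  | square (k l : ℕ) :
      WebRel a
        ((rungR 1 k l (k - 1) (l + 1) ⋗ rungL 1 (k - 1) (l + 1) k l) ∔
          (-1 : R) ∙ₛ (rungL 1 k l (k + 1) (l - 1) ⋗ rungR 1 (k + 1) (l - 1) k l))
        (coef R (q ^ (1 - (k : ℤ) + l) * qInt (k - l)) ∙ₛ idn (strand k ⊙ strand l))
  | serre₁ (k l r : ℕ) :
      WebRel a
        ((rung32 1 k l r (l + 1) (r - 1) ⋗ rung21 2 k (l + 1) (r - 1) (k + 2) (l - 1)) ∔
          (-1 : R) ∙ₛ (rung21 1 k l r (k + 1) (l - 1) ⋗ rung32 1 (k + 1) (l - 1) r l (r - 1) ⋗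
            rung21 1 (k + 1) l (r - 1) (k + 2) (l - 1)) ∔
          (rung21 2 k l r (k + 2) (l - 2) ⋗ rung32 1 (k + 2) (l - 2) r (l - 1) (r - 1)))
        (zero _ _)
  | serre₂ (k l r : ℕ) :
      WebRel a
        ((rung21 1 k l r (k + 1) (l - 1) ⋗ rung32 2 (k + 1) (l - 1) r (l + 1) (r - 2)) ∔
          (-1 : R) ∙ₛ (rung32 1 k l r (l + 1) (r - 1) ⋗ rung21 1 k (l + 1) (r - 1) (k + 1) l ⋗
            rung32 1 (k + 1) l (r - 1) (l + 1) (r - 2)) ∔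
          (rung32 2 k l r (l + 2) (r - 2) ⋗ rung21 1 k (l + 2) (r - 2) (k + 1) (l + 1)))
        (zero _ _)
  | serre₃ (k l r : ℕ) :
      WebRel a
        ((rung23 1 k l r (l - 1) (r + 1) ⋗ rung12 2 k (l - 1) (r + 1) (k - 2) (l + 1)) ∔
          (-1 : R) ∙ₛ (rung12 1 k l r (k - 1) (l + 1) ⋗ rung23 1 (k - 1) (l + 1) r l (r + 1) ⋗
            rung12 1 (k - 1) l (r + 1) (k - 2) (l + 1)) ∔
          (rung12 2 k l r (k - 2) (l + 2) ⋗ rung23 1 (k - 2) (l + 2) r (l + 1) (r + 1)))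
        (zero _ _)
  | serre₄ (k l r : ℕ) :
      WebRel a
        ((rung12 1 k l r (k - 1) (l + 1) ⋗ rung23 2 (k - 1) (l + 1) r (l - 1) (r + 2)) ∔
          (-1 : R) ∙ₛ (rung23 1 k l r (l - 1) (r + 1) ⋗ rung12 1 k (l - 1) (r + 1) (k - 1) l ⋗
            rung23 1 (k - 1) l (r + 1) (l - 1) (r + 2)) ∔
          (rung23 2 k l r (l - 2) (r + 2) ⋗ rung12 1 k (l - 2) (r + 2) (k - 1) (l - 1)))
        (zero _ _)
  -- mixed webs
  | circle (k : ℕ+) : WebRel a (cupUD k ⋗ capUD k) (circleValue a k ∙ₛ idn .unit)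
  | circle' (k : ℕ+) : WebRel a (cupDU k ⋗ capDU k) (circleValue a k ∙ₛ idn .unit)
  | sideway_digon_right : WebRel a sidewayDigonRight (bracket a 1 ∙ₛ idn (.up 1))
  | sideway_digon_left : WebRel a sidewayDigonLeft (bracket a 1 ∙ₛ idn (.up 1))
  | mixed_square :
      WebRel a (dumbbellToRight ⋗ dumbbellToLeft)
        (idn (.up 1 ⊙ .down 1) ∔ bracket a 2 ∙ₛ (capUD 1 ⋗ cupUD 1))
  | mixed_square_mirror :
      WebRel a (dumbbellToLeft ⋗ dumbbellToRight)
        (idn (.down 1 ⊙ .up 1) ∔ bracket a 2 ∙ₛ (capDU 1 ⋗ cupDU 1))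

end Relations

/-! ### The web categories -/

section Category

variable (R : Type u) [CommRing R] [Algebra Qq R]

/-- The specialization of the universal web category `∞Web` at an invertible element `a` of a
`ℚ(q)`-algebra `R`: the pivotal `R`-linear monoidal category generated by upward webs, with the
mixed relations. The usual formulas express the crossings of upward strands as combinations of
ladders, and the other crossings are rotations of these. Since all quantum integers `{k}`, `k ≥ 1`,
are invertible in `R`, the axioms of a braiding are consequences of the relations, so that
generating the category as a braided pivotal category gives the same result. -/
def Web (_a : R) : Type := WebObj

namespace Web

variable {R}
variable (a : R)

/-- The congruence of webs, as a setoid. -/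
def webSetoid (X Y : WebObj) : Setoid (WebTerm R X Y) where
  r := WebRel a
  iseqv := ⟨WebRel.refl, WebRel.symm, WebRel.trans⟩

/-- Linear combinations of webs from `X` to `Y`, modulo the relations. -/
def Hom (X Y : WebObj) : Type u := Quotient (webSetoid a X Y)

variable {a}

/-- The morphism represented by a formal combination of webs. -/
def mk {X Y : WebObj} (f : WebTerm R X Y) : Hom a X Y := Quotient.mk (webSetoid a X Y) f

theorem mk_eq {X Y : WebObj} {f g : WebTerm R X Y} (h : WebRel a f g) :
    (mk f : Hom a X Y) = mk g := Quotient.sound h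

/-- Composition of morphisms (stacking). -/
def comp {X Y Z : WebObj} (f : Hom a X Y) (g : Hom a Y Z) : Hom a X Z :=
  Quotient.map₂ WebTerm.comp (fun _ _ h _ _ h' => WebRel.comp_congr h h') f g

/-- Tensor product of morphisms (juxtaposition). -/
def tens {X Y X' Y' : WebObj} (f : Hom a X Y) (g : Hom a X' Y') :
    Hom a (X.tensor X') (Y.tensor Y') :=
  Quotient.map₂ WebTerm.tens (fun _ _ h _ _ h' => WebRel.tens_congr h h') f g

instance (X Y : WebObj) : Zero (Hom a X Y) := ⟨mk (.zero X Y)⟩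

instance (X Y : WebObj) : Add (Hom a X Y) :=
  ⟨Quotient.map₂ WebTerm.add (fun _ _ h _ _ h' => WebRel.add_congr h h')⟩

instance (X Y : WebObj) : SMul R (Hom a X Y) :=
  ⟨fun r => Quotient.map (WebTerm.smul r) (fun _ _ h => WebRel.smul_congr r h)⟩

instance (X Y : WebObj) : Neg (Hom a X Y) := ⟨fun f => (-1 : R) • f⟩

instance homAddCommGroup (X Y : WebObj) : AddCommGroup (Hom a X Y) where
  add_assoc := by rintro ⟨f⟩ ⟨g⟩ ⟨h⟩; exact mk_eq (.add_assoc f g h)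
  zero_add := by rintro ⟨f⟩; exact mk_eq (.zero_add f)
  add_zero := by rintro ⟨f⟩; exact mk_eq (.trans (.add_comm _ _) (.zero_add f))
  add_comm := by rintro ⟨f⟩ ⟨g⟩; exact mk_eq (.add_comm f g)
  neg_add_cancel := by
    rintro ⟨f⟩
    refine mk_eq (.trans (.add_congr (.refl _) (.symm (.one_smul f))) ?_)
    refine .trans (.symm (.add_smul _ _ f)) ?_
    rw [neg_add_cancel]
    exact .zero_smul f
  nsmul := nsmulRec
  zsmul := zsmulRec

instance homModule (X Y : WebObj) : Module R (Hom a X Y) where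
  one_smul := by rintro ⟨f⟩; exact mk_eq (.one_smul f)
  mul_smul := by rintro r s ⟨f⟩; exact mk_eq (.mul_smul r s f)
  smul_zero r := by
    refine mk_eq (.trans (.smul_congr r (.symm (.zero_smul (.zero _ _)))) ?_)
    refine .trans (.symm (.mul_smul _ _ _)) ?_
    rw [mul_zero]
    exact .zero_smul _
  smul_add := by rintro r ⟨f⟩ ⟨g⟩; exact mk_eq (.smul_add r f g)
  add_smul := by rintro r s ⟨f⟩; exact mk_eq (.add_smul r s f)
  zero_smul := by rintro ⟨f⟩; exact mk_eq (.zero_smul f)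

instance : Category (Web R a) where
  Hom X Y := Hom a X Y
  id X := mk (.idn X)
  comp f g := comp f g
  id_comp := by rintro X Y ⟨f⟩; exact mk_eq (.id_comp f)
  comp_id := by rintro X Y ⟨f⟩; exact mk_eq (.comp_id f)
  assoc := by rintro W X Y Z ⟨f⟩ ⟨g⟩ ⟨h⟩; exact mk_eq (.comp_assoc f g h)

instance : Preadditive (Web R a) where
  homGroup X Y := homAddCommGroup X Y
  add_comp := by rintro X Y Z ⟨f⟩ ⟨g⟩ ⟨h⟩; exact mk_eq (.add_comp f g h)
  comp_add := by rintro X Y Z ⟨f⟩ ⟨g⟩ ⟨h⟩; exact mk_eq (.comp_add f g h)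

instance : Linear R (Web R a) where
  homModule X Y := homModule X Y
  smul_comp := by rintro X Y Z r ⟨f⟩ ⟨g⟩; exact mk_eq (.smul_comp r f g)
  comp_smul := by rintro X Y Z ⟨f⟩ r ⟨g⟩; exact mk_eq (.comp_smul r f g)

instance : MonoidalCategoryStruct (Web R a) where
  tensorObj X Y := WebObj.tensor X Y
  tensorUnit := WebObj.unit
  tensorHom f g := tens f g
  whiskerLeft X _ _ f := tens (mk (.idn X)) f
  whiskerRight f Y := tens f (mk (.idn Y))
  associator X Y Z :=
    { hom := mk (.assoc X Y Z)
      inv := mk (.assocInv X Y Z)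
      hom_inv_id := mk_eq (.assoc_assocInv X Y Z)
      inv_hom_id := mk_eq (.assocInv_assoc X Y Z) }
  leftUnitor X :=
    { hom := mk (.lunit X)
      inv := mk (.lunitInv X)
      hom_inv_id := mk_eq (.lunit_lunitInv X)
      inv_hom_id := mk_eq (.lunitInv_lunit X) }
  rightUnitor X :=
    { hom := mk (.runit X)
      inv := mk (.runitInv X)
      hom_inv_id := mk_eq (.runit_runitInv X)
      inv_hom_id := mk_eq (.runitInv_runit X) }

instance : MonoidalCategory (Web R a) :=
  MonoidalCategory.ofTensorHom
    (id_tensorHom_id := fun X Y => mk_eq (.id_tens_id X Y))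
    (id_tensorHom := fun _ _ _ _ => rfl)
    (tensorHom_id := fun _ _ => rfl)
    (tensorHom_comp_tensorHom := by
      rintro _ _ _ _ _ _ ⟨f₁⟩ ⟨f₂⟩ ⟨g₁⟩ ⟨g₂⟩; exact mk_eq (.tens_comp_tens f₁ f₂ g₁ g₂))
    (associator_naturality := by
      rintro _ _ _ _ _ _ ⟨f₁⟩ ⟨f₂⟩ ⟨f₃⟩; exact mk_eq (.assoc_naturality f₁ f₂ f₃))
    (leftUnitor_naturality := by rintro _ _ ⟨f⟩; exact mk_eq (.lunit_naturality f))
    (rightUnitor_naturality := by rintro _ _ ⟨f⟩; exact mk_eq (.runit_naturality f))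
    (pentagon := fun W X Y Z => mk_eq (.pentagon W X Y Z))
    (triangle := fun X Y => mk_eq (.triangle X Y))

instance : MonoidalPreadditive (Web R a) where
  whiskerLeft_zero {X Y Z} := by
    have h := mk_eq (a := a) (.trans (.tens_congr (.refl (.idn X)) (.symm (.zero_smul (.zero Y Z))))
      (.trans (.tens_smul (0 : R) (.idn X) (.zero Y Z)) (.zero_smul _)))
    exact h
  zero_whiskerRight {X Y Z} := by
    have h := mk_eq (a := a) (.trans (.tens_congr (.symm (.zero_smul (.zero Y Z))) (.refl (.idn X)))
      (.trans (.smul_tens (0 : R) (.zero Y Z) (.idn X)) (.zero_smul _)))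
    exact h
  whiskerLeft_add := by rintro _ _ _ ⟨f⟩ ⟨g⟩; exact mk_eq (.tens_add _ f g)
  add_whiskerRight := by rintro _ _ _ ⟨f⟩ ⟨g⟩; exact mk_eq (.add_tens f g _)

instance : MonoidalLinear R (Web R a) where
  whiskerLeft_smul := by rintro _ _ _ r ⟨f⟩; exact mk_eq (.tens_smul r _ f)
  smul_whiskerRight := by rintro r _ _ ⟨f⟩ _; exact mk_eq (.smul_tens r f _)

/-- The upward arrow labelled `k`, as an object. -/
def up (k : ℕ+) : Web R a := WebObj.up k

/-- The downward arrow labelled `k`, as an object. -/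
def down (k : ℕ+) : Web R a := WebObj.down k

/-- The circle labelled `k` that goes up on the left and down on the right. -/
def circleUD (k : ℕ+) : 𝟙_ (Web R a) ⟶ 𝟙_ (Web R a) :=
  mk (WebTerm.comp (WebTerm.cupUD k) (WebTerm.capUD k))

/-- The circle labelled `k` that goes down on the left and up on the right. -/
def circleDU (k : ℕ+) : 𝟙_ (Web R a) ⟶ 𝟙_ (Web R a) :=
  mk (WebTerm.comp (WebTerm.cupDU k) (WebTerm.capDU k))

/-- The identities of the upward edges whose label is greater than `n`. -/
inductive LargeEdge (n : ℕ) : ∀ X Y : Web R a, (X ⟶ Y) → Prop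
  | mk (k : ℕ+) (hk : n < k) : LargeEdge n (up k) (up k) (𝟙 (up k))

end Web

/-- The category `xWeb`, over a `ℚ(q)`-algebra `R` that contains a square root `ν` of `δ_x⁻¹`:
the specialization of `∞Web` at `a = q ν δ_x`. -/
abbrev XWeb {R : Type u} [CommRing R] [Algebra Qq R] (x : ℚ) (ν : R) : Type :=
  Web R (coef R q * ν * coef R (qDelta x))

/-- The scalar `q^{k(k-1)} ν^k {x choose k}`. -/
def xCircleValue {R : Type u} [CommRing R] [Algebra Qq R] (x : ℚ) (ν : R) (k : ℕ) : R :=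
  coef R (q ^ (k * (k - 1))) * ν ^ k * coef R (qBinom x k)

end Category

/-! ### Quotients by tensor ideals -/

section Ideal

variable (R : Type*) [Semiring R] {C : Type*} [Category C] [Preadditive C] [Linear R C]
  [MonoidalCategory C]

/-- Membership in the two-sided tensor ideal of an `R`-linear monoidal category generated by a
family `S` of morphisms. -/
inductive InTensorIdeal (S : ∀ X Y : C, (X ⟶ Y) → Prop) : ∀ {X Y : C}, (X ⟶ Y) → Prop
  | of {X Y : C} {f : X ⟶ Y} (hf : S X Y f) : InTensorIdeal S f
  | zero (X Y : C) : InTensorIdeal S (0 : X ⟶ Y)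
  | add {X Y : C} {f g : X ⟶ Y} : InTensorIdeal S f → InTensorIdeal S g → InTensorIdeal S (f + g)
  | smul {X Y : C} (r : R) {f : X ⟶ Y} : InTensorIdeal S f → InTensorIdeal S (r • f)
  | comp_left {X Y Z : C} (f : X ⟶ Y) {g : Y ⟶ Z} : InTensorIdeal S g → InTensorIdeal S (f ≫ g)
  | comp_right {X Y Z : C} {f : X ⟶ Y} (g : Y ⟶ Z) : InTensorIdeal S f → InTensorIdeal S (f ≫ g)
  | whiskerLeft (Z : C) {X Y : C} {f : X ⟶ Y} : InTensorIdeal S f → InTensorIdeal S (Z ◁ f)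
  | whiskerRight {X Y : C} {f : X ⟶ Y} (Z : C) : InTensorIdeal S f → InTensorIdeal S (f ▷ Z)

/-- The component at `(X, Y)` of the tensor ideal generated by `S`. -/
def tensorIdeal (S : ∀ X Y : C, (X ⟶ Y) → Prop) (X Y : C) : Submodule R (X ⟶ Y) where
  carrier := {f | InTensorIdeal R S f}
  zero_mem' := .zero X Y
  add_mem' := .add
  smul_mem' r _ := .smul r

end Ideal

/-- The `R`-module `End(∅)` in the quotient of `xWeb` obtained by setting all edges with a label
`k > n` equal to zero. -/
abbrev BoundedEnd {R : Type u} [CommRing R] [Algebra Qq R] (x : ℚ) (ν : R) (n : ℕ) : Type u :=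
  (𝟙_ (XWeb x ν) ⟶ 𝟙_ (XWeb x ν)) ⧸
    tensorIdeal R (Web.LargeEdge n) (𝟙_ (XWeb x ν)) (𝟙_ (XWeb x ν))

/-- The class of the empty web in `BoundedEnd x ν n`. -/
def emptyWeb {R : Type u} [CommRing R] [Algebra Qq R] (x : ℚ) (ν : R) (n : ℕ) :
    BoundedEnd x ν n :=
  Submodule.Quotient.mk (𝟙 (𝟙_ (XWeb x ν)))

end

end QWeb

/-!
The element `1 + (q² - 1){x}` plays the role of `q^{2x}`: since `x` and `x + n` have the same
continued fraction up to the first entry, it is multiplied by `q^{2n}` when `x` is replaced by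
`x + n`. Hence `q² δ_x` is this element, and for `a = q ν δ_x` the factor
`(a q^{-i} - a⁻¹ q^i) / (q - q⁻¹)` of the value of a circle is `ν q^i {x - i}`.

A `q`-rational `{x}` is regular at `q = 1` with value `x`, so `{x - i}` vanishes only for `x = i`.
If `x` is not one of `0, …, n`, the value of the `(n + 1)`-labelled circle is therefore a unit. As
this circle factors through the edge labelled `n + 1`, killing that edge kills the empty web, and
with it every morphism.
-/

namespace QWeb

section Value

variable {K : Type*} [Field K] {c v w : K} {f g : RatFunc K}

/-- The rational function `f` is regular at the point `c` and takes the value `v` there. Regularity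
is part of the definition because `RatFunc.eval` is `0` at a pole. -/
def HasValueAt (c : K) (f : RatFunc K) (v : K) : Prop :=
  f.denom.eval₂ (RingHom.id K) c ≠ 0 ∧ f.eval (RingHom.id K) c = v

namespace HasValueAt

theorem const (c v : K) : HasValueAt c (RatFunc.C v) v := by
  simp [HasValueAt]

theorem zero (c : K) : HasValueAt c 0 0 := by
  simpa only [map_zero] using const c 0

theorem one (c : K) : HasValueAt c 1 1 := by
  simpa only [map_one] using const c 1

theorem X (c : K) : HasValueAt c RatFunc.X c := by
  simp [HasValueAt]

theorem add (hf : HasValueAt c f v) (hg : HasValueAt c g w) : HasValueAt c (f + g) (v + w) := by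
  refine ⟨fun h => mul_ne_zero hf.1 hg.1 ?_, by rw [RatFunc.eval_add _ _ hf.1 hg.1, hf.2, hg.2]⟩
  rw [← Polynomial.eval₂_mul]
  exact Polynomial.eval₂_eq_zero_of_dvd_of_eval₂_eq_zero _ _ (RatFunc.denom_add_dvd f g) h

theorem mul (hf : HasValueAt c f v) (hg : HasValueAt c g w) : HasValueAt c (f * g) (v * w) := by
  refine ⟨fun h => mul_ne_zero hf.1 hg.1 ?_, by rw [RatFunc.eval_mul _ _ hf.1 hg.1, hf.2, hg.2]⟩
  rw [← Polynomial.eval₂_mul]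
  exact Polynomial.eval₂_eq_zero_of_dvd_of_eval₂_eq_zero _ _ (RatFunc.denom_mul_dvd f g) h

theorem neg (hf : HasValueAt c f v) : HasValueAt c (-f) (-v) := by
  simpa only [map_neg, map_one, neg_one_mul] using (const c (-1)).mul hf

theorem sub (hf : HasValueAt c f v) (hg : HasValueAt c g w) : HasValueAt c (f - g) (v - w) := by
  simpa only [sub_eq_add_neg] using hf.add hg.neg

theorem ne_zero (hf : HasValueAt c f v) (hv : v ≠ 0) : f ≠ 0 := by
  rintro rfl
  exact hv (hf.2.symm.trans (RatFunc.eval_zero _ _))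

theorem inv (hf : HasValueAt c f v) (hv : v ≠ 0) : HasValueAt c f⁻¹ v⁻¹ := by
  have hf₀ : f ≠ 0 := hf.ne_zero hv
  have num_ne_zero : f.num.eval₂ (RingHom.id K) c ≠ 0 := fun h =>
    hv (by rw [← hf.2, RatFunc.eval, h, zero_div])
  have regular : f⁻¹.denom.eval₂ (RingHom.id K) c ≠ 0 := fun h => num_ne_zero <|
    Polynomial.eval₂_eq_zero_of_dvd_of_eval₂_eq_zero _ _ (RatFunc.denom_inv_dvd hf₀) h
  refine ⟨regular, eq_inv_of_mul_eq_one_right ?_⟩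
  rw [← hf.2, ← RatFunc.eval_mul _ _ hf.1 regular, mul_inv_cancel₀ hf₀, RatFunc.eval_one]

theorem div (hf : HasValueAt c f v) (hg : HasValueAt c g w) (hw : w ≠ 0) :
    HasValueAt c (f / g) (v / w) := by
  simpa only [div_eq_mul_inv] using hf.mul (hg.inv hw)

theorem pow (hf : HasValueAt c f v) (n : ℕ) : HasValueAt c (f ^ n) (v ^ n) := by
  induction n with
  | zero => simpa only [pow_zero] using one c
  | succ n ih => simpa only [pow_succ] using ih.mul hf

theorem zpow (hf : HasValueAt c f v) (hv : v ≠ 0) (n : ℤ) : HasValueAt c (f ^ n) (v ^ n) := by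
  cases n with
  | ofNat n => simpa only [Int.ofNat_eq_natCast, zpow_natCast] using hf.pow n
  | negSucc n => simpa only [zpow_negSucc] using (hf.pow (n + 1)).inv (pow_ne_zero _ hv)

theorem add_div_inv_fract [LinearOrder K] [FloorRing K] {u x : K} {f g p : RatFunc K}
    (hf : HasValueAt u f ⌊x⌋) (hp : HasValueAt u p 1) (hg : HasValueAt u g (Int.fract x)⁻¹)
    (hx : Int.fract x ≠ 0) : HasValueAt u (f + p / g) x := by
  simpa only [one_div, inv_inv, Int.floor_add_fract] using hf.add (hp.div hg (inv_ne_zero hx))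

end HasValueAt

end Value

section QuantumNumbers

theorem q_ne_zero : q ≠ 0 := RatFunc.X_ne_zero

theorem q_sq_sub_one_ne_zero : q ^ 2 - 1 ≠ 0 := by
  have value_at_zero := ((HasValueAt.X (0 : ℚ)).pow 2).sub (.one 0)
  exact value_at_zero.ne_zero (by norm_num)

theorem q_sub_inv_eq : q - q⁻¹ = (q ^ 2 - 1) / q := by
  have := q_ne_zero
  field_simp

theorem q_zpow_hasValueAt_one (n : ℤ) : HasValueAt 1 (q ^ n) 1 := by
  simpa only [q, one_zpow] using (HasValueAt.X (1 : ℚ)).zpow one_ne_zero n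

theorem one_add_mul_qInt (n : ℤ) : 1 + (q ^ 2 - 1) * qInt n = q ^ (2 * n) := by
  rw [qInt, mul_div_cancel₀ _ q_sq_sub_one_ne_zero, add_sub_cancel]

theorem qInt_zero : qInt 0 = 0 := by simp [qInt]

theorem qInt_one : qInt 1 = 1 := by
  rw [qInt, mul_one, zpow_ofNat, div_self q_sq_sub_one_ne_zero]

theorem qInt_add (m n : ℤ) : qInt (m + n) = qInt m + q ^ (2 * m) * qInt n := by
  refine mul_left_cancel₀ q_sq_sub_one_ne_zero (add_left_cancel (a := 1) ?_)
  rw [one_add_mul_qInt, mul_add, zpow_add₀ q_ne_zero, ← one_add_mul_qInt n]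
  linear_combination -(one_add_mul_qInt m)

theorem qInt_neg (n : ℤ) : qInt (-n) = -(q ^ (-(2 * n)) * qInt n) := by
  have h := qInt_add (-n) n
  rw [neg_add_cancel, qInt_zero, mul_neg] at h
  linear_combination -h

theorem qIntInv_eq (n : ℤ) : qIntInv n = q ^ (2 - 2 * n) * qInt n := by
  have := q_ne_zero
  have q_zpow_sub_one (m : ℤ) : q ^ (-(2 * m)) - 1 = -(q ^ (-(2 * m)) * (q ^ (2 * m) - 1)) := by
    rw [zpow_neg]
    field_simp
    ring
  have q_zpow_neg_two_sub_one : q ^ (-2 : ℤ) - 1 = -(q ^ (-2 : ℤ) * (q ^ 2 - 1)) := by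
    simpa only [mul_one, zpow_ofNat] using q_zpow_sub_one 1
  rw [qIntInv, q_zpow_sub_one, q_zpow_neg_two_sub_one, neg_div_neg_eq, mul_div_mul_comm,
    ← zpow_sub₀ q_ne_zero, qInt]
  ring_nf

theorem qIntInv_one : qIntInv 1 = 1 := by
  rw [qIntInv_eq, mul_one, sub_self, zpow_zero, one_mul, qInt_one]

theorem qInt_hasValueAt_one (n : ℤ) : HasValueAt 1 (qInt n) n := by
  induction n with
  | zero => simpa only [qInt_zero, Int.cast_zero] using HasValueAt.zero (1 : ℚ)
  | succ n ih =>
    simpa only [qInt_add, qInt_one, mul_one, Int.cast_add, Int.cast_one]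
      using ih.add (q_zpow_hasValueAt_one (2 * n))
  | pred n ih =>
    simpa only [sub_eq_add_neg, qInt_add, qInt_neg 1, qInt_one, mul_one, mul_neg, Int.cast_add,
      Int.cast_neg, Int.cast_one]
      using ih.add ((q_zpow_hasValueAt_one (2 * -n)).mul (q_zpow_hasValueAt_one (-2))).neg

theorem qIntInv_hasValueAt_one (n : ℤ) : HasValueAt 1 (qIntInv n) n := by
  simpa only [qIntInv_eq, one_mul]
    using (q_zpow_hasValueAt_one (2 - 2 * n)).mul (qInt_hasValueAt_one n)

end QuantumNumbers

section QRationals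

theorem evenCF_add_intCast (x : ℚ) (n : ℤ) :
    evenCF (x + n) = (((evenCF x).1.1 + n, (evenCF x).1.2), (evenCF x).2) := by
  rw [evenCF.eq_def, evenCF.eq_def x]
  simp only [Int.fract_add_intCast, Int.floor_add_intCast]
  split_ifs <;> simp only [add_sub_right_comm]

theorem qCF_eq_qInt_add (a b : ℤ) (l : List (ℤ × ℤ)) :
    qCF (a, b) l = qInt a + q ^ (2 * a) * qCF (0, b) l := by
  cases l <;> simp only [qCF, qInt_zero, mul_zero, zpow_zero, zero_add, mul_one_div]

theorem qRat_add_intCast (x : ℚ) (n : ℤ) : qRat (x + n) = qInt n + q ^ (2 * n) * qRat x := by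
  rw [qRat, qRat, evenCF_add_intCast, add_comm _ n, qCF_eq_qInt_add, qInt_add, mul_add 2,
    zpow_add₀ q_ne_zero, qCF_eq_qInt_add (evenCF x).1.1]
  ring

theorem qRat_intCast (n : ℤ) : qRat n = qInt n := by
  rw [qRat, evenCF.eq_def, if_pos (Int.fract_intCast n), Int.floor_intCast, qCF, qIntInv_one,
    div_one, ← mul_one (q ^ _), ← qInt_one, ← qInt_add, sub_add_cancel]

theorem qRat_hasValueAt_one (x : ℚ) : HasValueAt 1 (qRat x) x := by
  induction x using evenCF.induct with
  | case1 x hx =>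
    obtain ⟨n, rfl⟩ := Int.fract_eq_zero_iff.1 hx
    simpa only [qRat_intCast] using qInt_hasValueAt_one n
  | case2 x hx hy =>
    rw [qRat, evenCF.eq_def, if_neg hx, dif_pos hy, qCF]
    refine .add_div_inv_fract (qInt_hasValueAt_one _) (q_zpow_hasValueAt_one _) ?_ hx
    have floor_eq : (⌊(Int.fract x)⁻¹⌋ : ℚ) = (Int.fract x)⁻¹ := by
      simpa only [hy, add_zero] using Int.floor_add_fract (Int.fract x)⁻¹
    simpa only [floor_eq] using qIntInv_hasValueAt_one ⌊(Int.fract x)⁻¹⌋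
  | case3 x hx hy ih =>
    rw [qRat, evenCF.eq_def, if_neg hx, dif_neg hy, qCF]
    refine .add_div_inv_fract (qInt_hasValueAt_one _) (q_zpow_hasValueAt_one _) ?_ hx
    exact .add_div_inv_fract (qIntInv_hasValueAt_one _) (q_zpow_hasValueAt_one _) ih hy

/-- The element `1 + (q² - 1){x}`, which extends `n ↦ q^{2n}` from integers to rational
exponents. -/
noncomputable def qSqPow (x : ℚ) : Qq := 1 + (q ^ 2 - 1) * qRat x

theorem qSqPow_add_intCast (x : ℚ) (n : ℤ) : qSqPow (x + n) = q ^ (2 * n) * qSqPow x := by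
  rw [qSqPow, qSqPow, qRat_add_intCast, ← one_add_mul_qInt n]
  ring

theorem qRat_eq_qSqPow_sub_one_div (x : ℚ) : qRat x = (qSqPow x - 1) / (q ^ 2 - 1) := by
  rw [qSqPow, add_sub_cancel_left, mul_div_cancel_left₀ _ q_sq_sub_one_ne_zero]

theorem qSqPow_sub_natCast (x : ℚ) (i : ℕ) : qSqPow (x - i) = qSqPow x / q ^ (2 * i) := by
  have h := qSqPow_add_intCast (x - i) i
  rw [Int.cast_natCast, sub_add_cancel] at h
  rw [eq_div_iff (pow_ne_zero _ q_ne_zero), mul_comm, h]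
  norm_cast

theorem qSqPow_eq_mul_qDelta (x : ℚ) : qSqPow x = q ^ 2 * qDelta x := by
  have := q_ne_zero
  have := q_sq_sub_one_ne_zero
  have h : qSqPow (x - 1) = qSqPow x / q ^ 2 := by simpa using qSqPow_sub_natCast x 1
  rw [qDelta, qRat_eq_qSqPow_sub_one_div, qRat_eq_qSqPow_sub_one_div (x - 1), h]
  field_simp
  ring

theorem qDelta_ne_zero (x : ℚ) : qDelta x ≠ 0 := by
  have value_at_one := (qRat_hasValueAt_one x).sub (qRat_hasValueAt_one (x - 1))
  exact value_at_one.ne_zero (by norm_num)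

theorem qRat_ne_zero {x : ℚ} (hx : x ≠ 0) : qRat x ≠ 0 := (qRat_hasValueAt_one x).ne_zero hx

theorem qFactorial_ne_zero (k : ℕ) : qFactorial k ≠ 0 :=
  Finset.prod_ne_zero_iff.2 fun i _ =>
    (qInt_hasValueAt_one (i + 1)).ne_zero (by exact_mod_cast i.succ_ne_zero)

theorem qBinom_ne_zero {x : ℚ} {k : ℕ} (h : ¬ ∃ m : ℕ, x = m ∧ m < k) : qBinom x k ≠ 0 := by
  refine div_ne_zero (Finset.prod_ne_zero_iff.2 fun i hi => ?_) (qFactorial_ne_zero k)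
  exact qRat_ne_zero (sub_ne_zero.2 fun hxi => h ⟨i, hxi, Finset.mem_range.1 hi⟩)

end QRationals

section CircleValues

theorem q_pow_mul_qRat_sub_natCast (x : ℚ) (i : ℕ) :
    q ^ i * qRat (x - i) = (q - q⁻¹)⁻¹ * (q * qDelta x * q ^ (-(i : ℤ)) - q⁻¹ * q ^ i) := by
  have := q_ne_zero
  have := q_sq_sub_one_ne_zero
  rw [qRat_eq_qSqPow_sub_one_div, qSqPow_sub_natCast, qSqPow_eq_mul_qDelta, q_sub_inv_eq,
    zpow_neg, zpow_natCast, pow_mul']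
  field_simp

variable {R : Type u} [CommRing R] [Algebra Qq R] {x : ℚ} {ν : R}

theorem coef_qDelta_mul_sq (hν : ν ^ 2 = algebraMap Qq R (qDelta x)⁻¹) :
    coef R (qDelta x) * ν ^ 2 = 1 := by
  rw [hν, ← map_mul, mul_inv_cancel₀ (qDelta_ne_zero x), map_one]

theorem isUnit_of_sq_eq_inv_qDelta (hν : ν ^ 2 = algebraMap Qq R (qDelta x)⁻¹) : IsUnit ν :=
  (isUnit_pow_iff two_ne_zero).1 (.of_mul_eq_one_right _ (coef_qDelta_mul_sq hν))

theorem inverse_xWebParameter (hν : ν ^ 2 = algebraMap Qq R (qDelta x)⁻¹) :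
    Ring.inverse (coef R q * ν * coef R (qDelta x)) = coef R q⁻¹ * ν := by
  have hq : coef R q * coef R q⁻¹ = 1 := by
    rw [← map_mul, mul_inv_cancel₀ q_ne_zero, map_one]
  have mul_eq_one : coef R q * ν * coef R (qDelta x) * (coef R q⁻¹ * ν) = 1 := by
    linear_combination coef R q * coef R q⁻¹ * coef_qDelta_mul_sq hν + hq
  rw [← mul_one (Ring.inverse _)]
  exact (Ring.inverse_mul_eq_iff_eq_mul _ _ _ (.of_mul_eq_one _ mul_eq_one)).2 mul_eq_one.symm

theorem bracket_xWebParameter (hν : ν ^ 2 = algebraMap Qq R (qDelta x)⁻¹) (i : ℕ) :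
    bracket (coef R q * ν * coef R (qDelta x)) i = ν * coef R (q ^ i * qRat (x - i)) := by
  rw [bracket, inverse_xWebParameter hν, q_pow_mul_qRat_sub_natCast]
  simp only [coef, map_mul, map_sub]
  ring

theorem circleValue_xWebParameter (hν : ν ^ 2 = algebraMap Qq R (qDelta x)⁻¹) (k : ℕ) :
    circleValue (coef R q * ν * coef R (qDelta x)) k = xCircleValue x ν k := by
  have prod_bracket : ∏ i ∈ Finset.range k, bracket (coef R q * ν * coef R (qDelta x)) i =
      ν ^ k * coef R (q ^ (k * (k - 1) / 2) * ∏ i ∈ Finset.range k, qRat (x - i)) := by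
    simp only [bracket_xWebParameter hν, Finset.prod_mul_distrib, Finset.prod_const,
      Finset.card_range, ← map_prod]
    rw [Finset.prod_pow_eq_pow_sum, Finset.sum_range_id]
  have pow_eq : q ^ (k * (k - 1)) = q ^ (k * (k - 1) / 2) * q ^ (k * (k - 1) / 2) := by
    rw [← pow_add, ← two_mul, Nat.mul_div_cancel' (Nat.even_mul_pred_self k).two_dvd]
  rw [circleValue, prod_bracket, xCircleValue, qBinom, pow_eq]
  simp only [coef, map_mul, div_eq_mul_inv]
  ring

theorem isUnit_xCircleValue (hν : ν ^ 2 = algebraMap Qq R (qDelta x)⁻¹) {k : ℕ}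
    (h : ¬ ∃ m : ℕ, x = m ∧ m < k) : IsUnit (xCircleValue x ν k) :=
  (((pow_ne_zero _ q_ne_zero).isUnit.map _).mul ((isUnit_of_sq_eq_inv_qDelta hν).pow k)).mul
    ((qBinom_ne_zero h).isUnit.map _)

end CircleValues

section TensorIdeals

namespace InTensorIdeal

variable {R : Type*} [Semiring R] {C : Type*} [Category C] [Preadditive C] [Linear R C]
  [MonoidalCategory C] {S : ∀ X Y : C, (X ⟶ Y) → Prop}

theorem comp_of_id {X Y U V : C} (h : InTensorIdeal R S (𝟙 X)) (f : U ⟶ X ⊗ Y) (g : X ⊗ Y ⟶ V) :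
    InTensorIdeal R S (f ≫ g) := by
  simpa only [id_whiskerRight, Category.id_comp]
    using comp_left f (comp_right g (whiskerRight Y h))

theorem of_id_tensorUnit (h : InTensorIdeal R S (𝟙 (𝟙_ C))) {X Y : C} (f : X ⟶ Y) :
    InTensorIdeal R S f := by
  simpa only [Iso.inv_hom_id_assoc] using h.comp_of_id (λ_ X).inv ((λ_ X).hom ≫ f)

end InTensorIdeal

namespace Web

variable {R : Type u} [CommRing R] [Algebra Qq R] {a : R}

theorem circleUD_eq (k : ℕ+) :
    (circleUD k : 𝟙_ (Web R a) ⟶ 𝟙_ (Web R a)) = circleValue a k • 𝟙 (𝟙_ (Web R a)) :=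
  mk_eq (.circle k)

theorem circleDU_eq (k : ℕ+) :
    (circleDU k : 𝟙_ (Web R a) ⟶ 𝟙_ (Web R a)) = circleValue a k • 𝟙 (𝟙_ (Web R a)) :=
  mk_eq (.circle' k)

theorem circleUD_inTensorIdeal {n : ℕ} {k : ℕ+} (hk : n < k) :
    InTensorIdeal R (LargeEdge n) (circleUD k : 𝟙_ (Web R a) ⟶ 𝟙_ (Web R a)) :=
  InTensorIdeal.comp_of_id (.of (LargeEdge.mk k hk))
    (mk (.cupUD k) : 𝟙_ (Web R a) ⟶ up k ⊗ down k) (mk (.capUD k))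

theorem tensorIdeal_largeEdge_eq_top {n : ℕ} {k : ℕ+} (hk : n < k)
    (hu : IsUnit (circleValue a k)) (X Y : Web R a) :
    tensorIdeal R (LargeEdge n) X Y = ⊤ := by
  have smul_id_mem : circleValue a k • 𝟙 (𝟙_ (Web R a)) ∈ tensorIdeal R (LargeEdge n) _ _ := by
    rw [← circleUD_eq]
    exact circleUD_inTensorIdeal hk
  have id_mem : InTensorIdeal R (LargeEdge n) (𝟙 (𝟙_ (Web R a))) :=
    (Submodule.smul_mem_iff_of_isUnit _ hu).1 smul_id_mem
  exact eq_top_iff.2 fun f _ => id_mem.of_id_tensorUnit f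

end Web

theorem subsingleton_boundedEnd {R : Type u} [CommRing R] [Algebra Qq R] {x : ℚ} {ν : R}
    (hν : ν ^ 2 = algebraMap Qq R (qDelta x)⁻¹) {n : ℕ} (hn : ¬ ∃ m : ℕ, x = m ∧ m ≤ n) :
    Subsingleton (BoundedEnd x ν n) := by
  have hu : IsUnit (circleValue (coef R q * ν * coef R (qDelta x)) n.succPNat) := by
    rw [circleValue_xWebParameter hν]
    exact isUnit_xCircleValue hν (by simpa only [Nat.succPNat_coe, Nat.lt_succ_iff] using hn)
  exact Submodule.Quotient.subsingleton_iff.2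
    (Web.tensorIdeal_largeEdge_eq_top n.lt_succ_self hu _ _)

end TensorIdeals

end QWeb

theorem mainTheorem5 {R : Type u} [CommRing R] [Nontrivial R] [Algebra QWeb.Qq R] (x : ℚ)
    (ν : R) (hν : ν ^ 2 = algebraMap QWeb.Qq R (QWeb.qDelta x)⁻¹) :
    (∀ k : ℕ+,
      (QWeb.Web.circleUD k : 𝟙_ (QWeb.XWeb x ν) ⟶ 𝟙_ (QWeb.XWeb x ν)) =
          QWeb.xCircleValue x ν k • 𝟙 (𝟙_ (QWeb.XWeb x ν)) ∧
      (QWeb.Web.circleDU k : 𝟙_ (QWeb.XWeb x ν) ⟶ 𝟙_ (QWeb.XWeb x ν)) =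
          QWeb.xCircleValue x ν k • 𝟙 (𝟙_ (QWeb.XWeb x ν))) ∧
    (∀ k : ℕ, ¬ (∃ m : ℕ, x = m ∧ m < k) → QWeb.qBinom x k ≠ 0) ∧
    ∀ n : ℕ, ¬ (∃ m : ℕ, x = m ∧ m ≤ n) →
      QWeb.emptyWeb x ν n ∈ Submodule.torsion R (QWeb.BoundedEnd x ν n) := by
  refine ⟨fun k => ?_, fun k => QWeb.qBinom_ne_zero, fun n hn => ?_⟩
  · rw [← QWeb.circleValue_xWebParameter hν]
    exact ⟨QWeb.Web.circleUD_eq k, QWeb.Web.circleDU_eq k⟩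
  · have := QWeb.subsingleton_boundedEnd hν hn
    rw [Subsingleton.elim (QWeb.emptyWeb x ν n) 0]
    exact Submodule.zero_mem _
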